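/- Let $[k]_q=\frac{1-q^k}{1-q}$, $[k]_q!=\prod_{i=1}^k[i]_q$ (so $[0]_q!=1$), and call the quotients $\binom{m+l}{m,l}_q=\frac{[m+l]_q!}{[m]_q!\,[l]_q!}$ with integers $m,l\ge 0$ the $q$-binomial coefficients. For a finite rooted tree $T$ let $D(T)$ be the multiset $\{d(v) : v\in V(T)\}$, where $d(v)$ is the number of descendants of the vertex $v$ ($v$ itself not counted). Theorem 5.2. Let $n\ge 1$ and let $0\le a_1\le a_2\le\cdots\le a_n$ be integers. There exists a finite rooted tree $T$ with $D(T)=\{a_1,a_2,\dots,a_n\}$ (as multisets) if and only if $a_n=n-1$ and the rational function $$\frac{[a_n]_q!}{\prod_{i=1}^{n-1}[a_i+1]_q}$$ is equal to a product of finitely many $q$-binomial coefficients. -/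

import Mathlib

/-- The `q`-number `[n]_q = (1 - q ^ n) / (1 - q)`, an element of the field `ℚ(q)`. -/
noncomputable def qNumber (n : ℕ) : RatFunc ℚ :=
  (1 - RatFunc.X ^ n) / (1 - RatFunc.X)

/-- The `q`-factorial `[n]_q! = [1]_q [2]_q ⋯ [n]_q`. -/
noncomputable def qFactorial (n : ℕ) : RatFunc ℚ :=
  ∏ i ∈ Finset.Icc 1 n, qNumber i

/-- The `q`-binomial coefficient `[m + n]_q! / ([m]_q! [n]_q!)`. -/
noncomputable def qBinomial (m n : ℕ) : RatFunc ℚ :=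
  qFactorial (m + n) / (qFactorial m * qFactorial n)

/-- `f` is the product of finitely many `q`-binomial coefficients (repetitions allowed). -/
def IsProdQBinomial (f : RatFunc ℚ) : Prop :=
  ∃ s : Multiset (ℕ × ℕ), f = (s.map fun p => qBinomial p.1 p.2).prod

/-- The number `d(v)` of descendants of a vertex `v` of a rooted tree. In a `RootedTree` the root
is the bottom element, the parent of a vertex is its predecessor, and `v < w` says that `v ≠ w`
lies on the path from the root to `w`, so the descendants of `v` are the elements above it. -/
noncomputable def RootedTree.numDescendants (T : RootedTree) (v : T) : ℕ :=
  (Set.Ioi v).ncard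

/-- The multiset `D(T) = {d(v) | v ∈ V(T)}` of a finite rooted tree, one entry for each vertex. -/
noncomputable def RootedTree.descendantCounts (T : RootedTree) [Fintype T] : Multiset ℕ :=
  (Finset.univ : Finset T).val.map T.numDescendants

/-! Work with hook lengths `d(v) + 1`. In a forest, an upper set either has a least element, whose
hook cancels the top factor of the `q`-factorial, or splits into two smaller upper sets at the cost
of one `q`-binomial (`IsForestOrder.isProdQBinomial`). For a tree, the root is removed first.

Conversely, the `[k]_q` with `k ≥ 2` are multiplicatively independent, so the hypothesis is an
identity of formal products. It can be unwound into a forest (`exists_multiset_of_countP_eq`): the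
largest outstanding size `K` is either a hook, which becomes a root over a forest of size `K - 1`,
or the top of some binomial `(m, l)`, which makes the forest a disjoint union of sizes `m` and `l`.
A new bottom element turns the final forest into a tree. -/

theorem one_sub_X_ne_zero : (1 - RatFunc.X : RatFunc ℚ) ≠ 0 := by
  have h : (1 - Polynomial.X : Polynomial ℚ) ≠ 0 := by
    intro h
    simpa using congrArg (Polynomial.eval 0) h
  have := (map_ne_zero_iff _ (RatFunc.algebraMap_injective ℚ)).2 h
  simpa using this

/-- The `q`-numbers are the geometric sums `1 + q + ⋯ + q ^ (n - 1)`. -/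
theorem qNumber_eq_algebraMap (n : ℕ) :
    qNumber n =
      algebraMap (Polynomial ℚ) (RatFunc ℚ) (∑ i ∈ Finset.range n, Polynomial.X ^ i) := by
  rw [qNumber, div_eq_iff one_sub_X_ne_zero]
  have h := congrArg (algebraMap (Polynomial ℚ) (RatFunc ℚ))
    (geom_sum_mul_neg (Polynomial.X : Polynomial ℚ) n)
  rw [map_mul] at h
  simpa using h.symm

theorem qNumber_ne_zero {n : ℕ} (hn : 1 ≤ n) : qNumber n ≠ 0 := by
  rw [qNumber_eq_algebraMap, map_ne_zero_iff _ (RatFunc.algebraMap_injective ℚ)]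
  intro h
  have h0 := congrArg (Polynomial.eval 1) h
  simp at h0
  omega

@[simp] theorem qNumber_one : qNumber 1 = 1 := by simp [qNumber_eq_algebraMap]

theorem qFactorial_ne_zero (n : ℕ) : qFactorial n ≠ 0 :=
  Finset.prod_ne_zero_iff.2 fun _ hi => qNumber_ne_zero (Finset.mem_Icc.1 hi).1

@[simp] theorem qFactorial_zero : qFactorial 0 = 1 := by simp [qFactorial]

theorem qFactorial_succ (n : ℕ) : qFactorial (n + 1) = qFactorial n * qNumber (n + 1) := by
  rw [qFactorial, qFactorial, Finset.prod_Icc_succ_top (by omega)]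

@[simp] theorem qBinomial_zero_right (m : ℕ) : qBinomial m 0 = 1 := by
  simp [qBinomial, qFactorial_ne_zero]

@[simp] theorem qBinomial_zero_left (m : ℕ) : qBinomial 0 m = 1 := by
  simp [qBinomial, qFactorial_ne_zero]

/-! ### Products of `q`-binomial coefficients. -/

theorem IsProdQBinomial.one : IsProdQBinomial 1 := ⟨0, by simp⟩

theorem IsProdQBinomial.mul {f g : RatFunc ℚ} (hf : IsProdQBinomial f) (hg : IsProdQBinomial g) :
    IsProdQBinomial (f * g) := by
  obtain ⟨s, rfl⟩ := hf
  obtain ⟨t, rfl⟩ := hg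
  exact ⟨s + t, by simp⟩

theorem isProdQBinomial_qBinomial (m l : ℕ) : IsProdQBinomial (qBinomial m l) :=
  ⟨{(m, l)}, by simp⟩

/-- Trivial factors can be omitted from a product of `q`-binomial coefficients. -/
theorem IsProdQBinomial.exists_pos {f : RatFunc ℚ} (hf : IsProdQBinomial f) :
    ∃ s : Multiset (ℕ × ℕ), (∀ p ∈ s, 1 ≤ p.1 ∧ 1 ≤ p.2) ∧
      f = (s.map fun p => qBinomial p.1 p.2).prod := by
  obtain ⟨s, rfl⟩ := hf
  induction s using Multiset.induction with
  | empty => exact ⟨0, by simp⟩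
  | cons p s ih =>
    obtain ⟨t, ht, h⟩ := ih
    obtain ⟨m, l⟩ := p
    rcases Nat.eq_zero_or_pos m with rfl | hm
    · exact ⟨t, ht, by simpa using h⟩
    rcases Nat.eq_zero_or_pos l with rfl | hl
    · exact ⟨t, ht, by simpa using h⟩
    refine ⟨(m, l) ::ₘ t, ?_, by simp [h]⟩
    intro p hp
    rcases Multiset.mem_cons.1 hp with rfl | hp
    · exact ⟨hm, hl⟩
    · exact ht p hp

/-! ### Multiplicative independence of the `q`-numbers. -/

theorem geom_sum_eq_zero_iff_dvd {k : ℕ} (hk : 2 ≤ k) {ζ : ℂ} (hζ : IsPrimitiveRoot ζ k) (j : ℕ) :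
    ∑ i ∈ Finset.range j, ζ ^ i = 0 ↔ k ∣ j := by
  have h1 : ζ - 1 ≠ 0 := sub_ne_zero.2 (hζ.ne_one (by omega))
  rw [← hζ.pow_eq_one_iff_dvd, ← sub_eq_zero (a := ζ ^ j), ← geom_sum_mul, mul_eq_zero, or_iff_left h1]

/-- If `[k]_q` occurs in a product of `q`-numbers, then every equal product of `q`-numbers has a
factor `[j]_q` with `k ∣ j`. -/
theorem exists_dvd_of_prod_qNumber_eq {A B : Multiset ℕ}
    (h : (A.map qNumber).prod = (B.map qNumber).prod) {k : ℕ} (hk : 2 ≤ k) (hA : k ∈ A) :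
    ∃ j ∈ B, k ∣ j := by
  have key : ∀ C : Multiset ℕ, (C.map qNumber).prod = algebraMap (Polynomial ℚ) (RatFunc ℚ)
      (C.map fun n => ∑ i ∈ Finset.range n, (Polynomial.X : Polynomial ℚ) ^ i).prod := by
    intro C
    rw [map_multiset_prod, Multiset.map_map]
    exact congrArg _ (Multiset.map_congr rfl fun n _ => qNumber_eq_algebraMap n)
  rw [key, key] at h
  have h' := RatFunc.algebraMap_injective ℚ h
  have hζ := Complex.isPrimitiveRoot_exp k (by omega)
  have ev : ∀ C : Multiset ℕ, (Polynomial.aeval (Complex.exp (2 * Real.pi * Complex.I / k))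
      (C.map fun n => ∑ i ∈ Finset.range n, (Polynomial.X : Polynomial ℚ) ^ i).prod) = 0 ↔
      ∃ j ∈ C, k ∣ j := by
    intro C
    rw [map_multiset_prod, Multiset.prod_eq_zero_iff, Multiset.map_map]
    simp [geom_sum_eq_zero_iff_dvd hk hζ]
  rw [← ev, ← h', ev]
  exact ⟨k, hA, dvd_rfl⟩

/-- The `q`-numbers `[k]_q` with `k ≥ 2` are multiplicatively independent. -/
theorem eq_of_prod_qNumber_eq {A B : Multiset ℕ} (hA : ∀ k ∈ A, 2 ≤ k) (hB : ∀ k ∈ B, 2 ≤ k)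
    (h : (A.map qNumber).prod = (B.map qNumber).prod) : A = B := by
  induction hc : A.card generalizing A B with
  | zero =>
    obtain rfl := Multiset.card_eq_zero.1 hc
    by_contra hne
    obtain ⟨k, hk⟩ := Multiset.exists_mem_of_ne_zero (Ne.symm hne)
    obtain ⟨j, hj, -⟩ := exists_dvd_of_prod_qNumber_eq h.symm (hB k hk) hk
    simp at hj
  | succ c ih =>
    have hA0 : A ≠ 0 := by rintro rfl; simp at hc
    obtain ⟨k, hkA, hmax⟩ : ∃ k ∈ A, ∀ j ∈ A, j ≤ k := by
      obtain ⟨x, hx⟩ := Multiset.exists_mem_of_ne_zero hA0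
      obtain ⟨k, hk, hm⟩ := A.toFinset.exists_max_image id ⟨x, Multiset.mem_toFinset.2 hx⟩
      exact ⟨k, Multiset.mem_toFinset.1 hk, fun j hj => hm j (Multiset.mem_toFinset.2 hj)⟩
    -- `k` divides some `j ∈ B`, which divides some `i ∈ A`; maximality of `k` forces `i = j = k`.
    have hkB : k ∈ B := by
      obtain ⟨j, hj, hkj⟩ := exists_dvd_of_prod_qNumber_eq h (hA k hkA) hkA
      obtain ⟨i, hi, hji⟩ := exists_dvd_of_prod_qNumber_eq h.symm (hB j hj) hj
      have h1 := Nat.le_of_dvd (by have := hB j hj; omega) hkj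
      have h2 := Nat.le_of_dvd (by have := hA i hi; omega) hji
      have h3 := hmax i hi
      rwa [show k = j by omega]
    obtain ⟨A, rfl⟩ := Multiset.exists_cons_of_mem hkA
    obtain ⟨B, rfl⟩ := Multiset.exists_cons_of_mem hkB
    rw [ih (fun j hj => hA j (Multiset.mem_cons_of_mem hj))
      (fun j hj => hB j (Multiset.mem_cons_of_mem hj)) _ (by simpa using hc)]
    have := hA k hkA
    simpa [qNumber_ne_zero (show 1 ≤ k by omega)] using h

/-- Since `[1]_q = 1`, copies of `1` are invisible in a product; only multiplicities of `k ≥ 2` can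
be recovered. -/
theorem prod_qNumber_filter (A : Multiset ℕ) (hA : ∀ k ∈ A, 1 ≤ k) :
    ((A.filter (2 ≤ ·)).map qNumber).prod = (A.map qNumber).prod := by
  induction A using Multiset.induction with
  | empty => simp
  | cons k A ih =>
    have ih := ih fun j hj => hA j (Multiset.mem_cons_of_mem hj)
    have hk := hA k (Multiset.mem_cons_self k A)
    by_cases h2 : 2 ≤ k
    · rw [Multiset.filter_cons_of_pos _ h2, Multiset.map_cons, Multiset.prod_cons, ih,
        Multiset.map_cons, Multiset.prod_cons]
    · obtain rfl : k = 1 := by omega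
      rw [Multiset.filter_cons_of_neg _ h2, ih]
      simp

theorem count_eq_of_prod_qNumber_eq {A B : Multiset ℕ} (hA : ∀ k ∈ A, 1 ≤ k)
    (hB : ∀ k ∈ B, 1 ≤ k) (h : (A.map qNumber).prod = (B.map qNumber).prod) {k : ℕ} (hk : 2 ≤ k) :
    A.count k = B.count k := by
  rw [← prod_qNumber_filter A hA, ← prod_qNumber_filter B hB] at h
  have := eq_of_prod_qNumber_eq (by simp) (by simp) h
  have := congrArg (Multiset.count k) this
  simpa [Multiset.count_filter, hk] using this

/-- If a quotient of `q`-numbers is a product of `q`-binomial coefficients, then the two sides agree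
as formal products of symbols `[k]_q`. -/
theorem count_eq_of_qFactorial_div_eq {n : ℕ} {H : Multiset ℕ} (hH : ∀ k ∈ H, 1 ≤ k)
    {s : Multiset (ℕ × ℕ)}
    (h : qFactorial n / (H.map qNumber).prod = (s.map fun p => qBinomial p.1 p.2).prod) {k : ℕ}
    (hk : 2 ≤ k) :
    ({n} : Multiset ℕ).countP (k ≤ ·) + s.countP (fun p => k ≤ p.1) + s.countP (fun p => k ≤ p.2)
      = H.count k + s.countP (fun p => k ≤ p.1 + p.2) := by
  have hH0 : (H.map qNumber).prod ≠ 0 := by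
    rw [Ne, Multiset.prod_eq_zero_iff, Multiset.mem_map]
    rintro ⟨j, hj, h0⟩
    exact qNumber_ne_zero (hH j hj) h0
  -- `I m` is the formal version of `[m]_q!`: it contains `k ≥ 2` once if `k ≤ m` and not otherwise,
  -- whence the `countP` terms.
  let I : ℕ → Multiset ℕ := fun m => (Finset.Icc 1 m).val
  have hI : ∀ m, ((I m).map qNumber).prod = qFactorial m := fun m => rfl
  have hI1 : ∀ m, ∀ j ∈ I m, 1 ≤ j := fun m j hj => (Finset.mem_Icc.1 hj).1
  have hIc : ∀ m, (I m).count k = if k ≤ m then 1 else 0 := by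
    intro m
    rw [Multiset.count_eq_of_nodup (Finset.Icc 1 m).nodup]
    exact if_congr (by rw [Finset.mem_val, Finset.mem_Icc]; omega) rfl rfl
  have hcount : ∀ (t : Multiset (ℕ × ℕ)) (f : ℕ × ℕ → ℕ),
      ((t.map fun p => I (f p)).sum).count k = t.countP fun p => k ≤ f p := by
    intro t f
    induction t using Multiset.induction with
    | empty => simp
    | cons p t ih => rw [Multiset.map_cons, Multiset.sum_cons, Multiset.count_add, ih, hIc,
        Multiset.countP_cons, add_comm]
  have hge : ∀ (t : Multiset (ℕ × ℕ)) (f : ℕ × ℕ → ℕ),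
      ∀ j ∈ (t.map fun p => I (f p)).sum, 1 ≤ j := by
    intro t f
    induction t using Multiset.induction with
    | empty => simp
    | cons p t ih =>
      intro j hj
      rw [Multiset.map_cons, Multiset.sum_cons, Multiset.mem_add] at hj
      exact hj.elim (hI1 _ j) (ih j)
  have hprod : ∀ t : Multiset (ℕ × ℕ), (t.map fun p => qBinomial p.1 p.2).prod *
      ((((t.map fun p => I p.1).sum + (t.map fun p => I p.2).sum)).map qNumber).prod =
      (((t.map fun p => I (p.1 + p.2)).sum).map qNumber).prod := by
    intro t
    induction t using Multiset.induction with
    | empty => simp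
    | cons p t ih =>
      simp only [Multiset.map_cons, Multiset.sum_cons, Multiset.map_add, Multiset.prod_add,
        Multiset.prod_cons, hI] at ih ⊢
      rw [← ih, qBinomial]
      have h1 := qFactorial_ne_zero p.1
      have h2 := qFactorial_ne_zero p.2
      field_simp
  have main := count_eq_of_prod_qNumber_eq (k := k)
    (A := I n + ((s.map fun p => I p.1).sum + (s.map fun p => I p.2).sum))
    (B := H + (s.map fun p => I (p.1 + p.2)).sum) ?_ ?_ ?_ hk
  · simp only [Multiset.count_add, hcount, hIc] at main
    rw [← main, ← Multiset.cons_zero, Multiset.countP_cons]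
    simp [add_assoc]
  · intro j hj
    simp only [Multiset.mem_add] at hj
    rcases hj with hj | hj | hj
    exacts [hI1 _ j hj, hge _ _ j hj, hge _ _ j hj]
  · intro j hj
    rcases Multiset.mem_add.1 hj with hj | hj
    exacts [hH j hj, hge _ _ j hj]
  · rw [Multiset.map_add, Multiset.prod_add, hI, Multiset.map_add _ H, Multiset.prod_add,
      ← hprod, ← h]
    field_simp

/-! ### Unwinding a formal identity into a forest. -/

/-- If a formal product of symbols `[k]`, `k ≥ 2`, is a quotient of factorials by binomials, the
factorials indexed by `P`, then the symbols are, up to copies of `1`, distributed among multisets of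
the sizes prescribed by `P` that belong to a class closed under sums and under adding the
element `card G + 1` to `G`. -/
theorem exists_multiset_of_countP_eq {S : Multiset ℕ → Prop} (h0 : S 0)
    (hadd : ∀ G G', S G → S G' → S (G + G')) (hcons : ∀ G, S G → S ((G.card + 1) ::ₘ G))
    (P H : Multiset ℕ) (B : Multiset (ℕ × ℕ)) (hH : ∀ k ∈ H, 2 ≤ k)
    (hB : ∀ p ∈ B, 1 ≤ p.1 ∧ 1 ≤ p.2)
    (heq : ∀ k, 2 ≤ k → P.countP (k ≤ ·) + B.countP (fun p => k ≤ p.1) +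
      B.countP (fun p => k ≤ p.2) = H.count k + B.countP (fun p => k ≤ p.1 + p.2)) :
    ∃ (s : Multiset (Multiset ℕ)) (r : ℕ), (∀ G ∈ s, S G) ∧ s.map Multiset.card = P ∧
      s.sum = H + Multiset.replicate r 1 := by
  -- The square makes splitting `m + l` into `m, l ≥ 1` decrease the measure; the `+ 1` makes
  -- discarding a size `0` decrease it.
  induction hN : (P.map fun k => k ^ 2 + 1).sum using Nat.strong_induction_on
    generalizing P H B with
  | _ N ih =>
  -- At the largest binomial top, if it exceeded `K`, every term on the left of `heq` would vanish
  -- while the right is positive.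
  have hBmax : ∀ K, 1 ≤ K → (∀ k ∈ P, k ≤ K) → ∀ p ∈ B, p.1 + p.2 ≤ K := by
    intro K hK hPK p hp
    by_contra hlt
    obtain ⟨q, hq, hqm⟩ := B.toFinset.exists_max_image (fun p => p.1 + p.2)
      ⟨p, Multiset.mem_toFinset.2 hp⟩
    rw [Multiset.mem_toFinset] at hq
    have hq' : ∀ p ∈ B, p.1 + p.2 ≤ q.1 + q.2 := fun p hp => hqm p (Multiset.mem_toFinset.2 hp)
    have hqp := hq' p hp
    have e := heq (q.1 + q.2) (by omega)
    rw [Multiset.countP_eq_zero.2 fun k hk => by have := hPK k hk; omega,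
      Multiset.countP_eq_zero.2 fun p hp => by have := hq' p hp; have := hB p hp; omega,
      Multiset.countP_eq_zero.2 fun p hp => by have := hq' p hp; have := hB p hp; omega] at e
    have : 0 < B.countP (fun p => q.1 + q.2 ≤ p.1 + p.2) :=
      Multiset.countP_pos.2 ⟨q, hq, le_rfl⟩
    omega
  rcases eq_or_ne P 0 with rfl | hP
  · have hB0 : B = 0 := Multiset.eq_zero_of_forall_notMem fun p hp => by
      have := hBmax 1 le_rfl (by simp) p hp
      have := hB p hp
      omega
    subst hB0
    have hH0 : H = 0 := Multiset.eq_zero_of_forall_notMem fun k hk => by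
      have e := heq k (hH k hk)
      have := Multiset.count_pos.2 hk
      simp at e
      omega
    subst hH0
    exact ⟨0, 0, by simp⟩
  obtain ⟨K, hKP, hmax⟩ : ∃ K ∈ P, ∀ k ∈ P, k ≤ K := by
    obtain ⟨x, hx⟩ := Multiset.exists_mem_of_ne_zero hP
    obtain ⟨k, hk, hm⟩ := P.toFinset.exists_max_image id ⟨x, Multiset.mem_toFinset.2 hx⟩
    exact ⟨k, Multiset.mem_toFinset.1 hk, fun j hj => hm j (Multiset.mem_toFinset.2 hj)⟩
  obtain ⟨P, rfl⟩ := Multiset.exists_cons_of_mem hKP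
  rcases Nat.eq_zero_or_pos K with rfl | hK
  · obtain ⟨s, r, hs, hsP, hsum⟩ := ih _ (by rw [← hN]; simp) P H B hH hB (by
      intro k hk
      rw [← heq k hk, Multiset.countP_cons_of_neg _ (by omega)]) rfl
    refine ⟨0 ::ₘ s, r, ?_, by simp [hsP], by simpa using hsum⟩
    intro G hG
    rcases Multiset.mem_cons.1 hG with rfl | hG
    exacts [h0, hs G hG]
  -- Use `K` as a root hook and leave size `K - 1`. Here `e` is `1` when `K = 1`, a leaf hook that
  -- `H` does not record, and `0` otherwise.
  have emit : ∀ H' e, K ::ₘ H' = H + Multiset.replicate e 1 → (∀ k ∈ H', 2 ≤ k) →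
      ∃ (s : Multiset (Multiset ℕ)) (r : ℕ), (∀ G ∈ s, S G) ∧ s.map Multiset.card = K ::ₘ P ∧
        s.sum = H + Multiset.replicate r 1 := by
    intro H' e hHe hH'
    obtain ⟨s, r, hs, hsP, hsum⟩ := ih (((K - 1) ::ₘ P).map fun k => k ^ 2 + 1).sum (by
      rw [← hN]
      obtain ⟨K, rfl⟩ := Nat.exists_eq_succ_of_ne_zero hK.ne'
      simp only [Multiset.map_cons, Multiset.sum_cons, Nat.succ_eq_add_one, Nat.add_sub_cancel]
      nlinarith) ((K - 1) ::ₘ P) H' B hH' hB (by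
      intro k hk
      have e1 := heq k hk
      have e2 := congrArg (Multiset.count k) hHe
      rw [Multiset.count_add, Multiset.count_replicate, if_neg (by omega),
        Multiset.count_cons] at e2
      rw [Multiset.countP_cons] at e1 ⊢
      split_ifs at * <;> omega) rfl
    obtain ⟨G, hG, hGc, hGP⟩ := (Multiset.map_eq_cons _ _ _ _).2 hsP
    obtain ⟨s, rfl⟩ := Multiset.exists_cons_of_mem hG
    rw [Multiset.erase_cons_head] at hGP
    have hc : G.card + 1 = K := by omega
    refine ⟨(K ::ₘ G) ::ₘ s, e + r, ?_, by simp [hc, hGP], ?_⟩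
    · intro G' hG'
      rcases Multiset.mem_cons.1 hG' with rfl | hG'
      · rw [← hc]
        exact hcons G (hs G (Multiset.mem_cons_self G s))
      · exact hs G' (Multiset.mem_cons_of_mem hG')
    · rw [Multiset.sum_cons] at hsum ⊢
      rw [Multiset.replicate_add, ← add_assoc, ← hHe, Multiset.cons_add, hsum, Multiset.cons_add]
  rcases (show K = 1 ∨ 2 ≤ K by omega) with rfl | hK2
  · exact emit H 1 (by rw [Multiset.replicate_one, add_comm, Multiset.singleton_add]) hH
  by_cases hKH : K ∈ H
  · obtain ⟨H', rfl⟩ := Multiset.exists_cons_of_mem hKH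
    exact emit H' 0 (by simp) fun k hk => hH k (Multiset.mem_cons_of_mem hk)
  -- `K` is no hook, so its occurrence in `P` must be balanced by a binomial with top `K`.
  have e := heq K hK2
  rw [Multiset.countP_cons_of_pos _ le_rfl, Multiset.count_eq_zero_of_notMem hKH] at e
  obtain ⟨p, hp, hKp⟩ : ∃ p ∈ B, K ≤ p.1 + p.2 := Multiset.countP_pos.1 (by omega)
  have hpK : p.1 + p.2 = K := le_antisymm (hBmax K hK hmax p hp) hKp
  obtain ⟨B, rfl⟩ := Multiset.exists_cons_of_mem hp
  obtain ⟨m, l⟩ := p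
  obtain ⟨hm, hl⟩ := hB _ hp
  simp only at hpK hm hl
  subst hpK
  obtain ⟨s, r, hs, hsP, hsum⟩ := ih ((m ::ₘ l ::ₘ P).map fun k => k ^ 2 + 1).sum (by
    rw [← hN]
    simp only [Multiset.map_cons, Multiset.sum_cons]
    nlinarith) (m ::ₘ l ::ₘ P) H B hH (fun p hp => hB p (Multiset.mem_cons_of_mem hp)) (by
    intro k hk
    have e1 := heq k hk
    simp only [Multiset.countP_cons] at e1 ⊢
    omega) rfl
  obtain ⟨G, hG, hGc, hGP⟩ := (Multiset.map_eq_cons _ _ _ _).2 hsP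
  obtain ⟨s, rfl⟩ := Multiset.exists_cons_of_mem hG
  rw [Multiset.erase_cons_head] at hGP
  obtain ⟨G', hG', hGc', hGP'⟩ := (Multiset.map_eq_cons _ _ _ _).2 hGP
  obtain ⟨s, rfl⟩ := Multiset.exists_cons_of_mem hG'
  rw [Multiset.erase_cons_head] at hGP'
  refine ⟨(G + G') ::ₘ s, r, ?_, by simp [hGc, hGc', hGP'], by rw [← hsum]; simp [add_assoc]⟩
  intro F hF
  rcases Multiset.mem_cons.1 hF with rfl | hF
  · exact hadd G G' (hs G hG) (hs G' (Multiset.mem_cons_of_mem hG'))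
  · exact hs F (Multiset.mem_cons_of_mem (Multiset.mem_cons_of_mem hF))

/-! ### Forest orders, hook lengths and rooted trees. -/

/-- A partial order is a forest order if the elements below any given one form a chain. -/
def IsForestOrder (α : Type*) [PartialOrder α] : Prop :=
  ∀ x y z : α, x ≤ z → y ≤ z → x ≤ y ∨ y ≤ x

/-- The multiset of hook lengths of a finite partial order: the sizes of its principal upper
sets. -/
noncomputable def hookLengths (α : Type*) [Fintype α] [PartialOrder α] : Multiset ℕ :=
  (Finset.univ : Finset α).val.map fun v => (Set.Ici v).ncard

/-- A multiset is a forest hook multiset if it consists of the hook lengths of a finite forest. -/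
def IsForestHookMultiset (G : Multiset ℕ) : Prop :=
  ∃ (α : Type) (_ : Fintype α) (_ : PartialOrder α), IsForestOrder α ∧ hookLengths α = G

theorem RootedTree.isForestOrder (T : RootedTree) : IsForestOrder T :=
  fun _ _ _ hx hy => (le_total_of_directed hx hy).symm

theorem ncard_Ici {α : Type*} [Finite α] [PartialOrder α] (v : α) :
    (Set.Ici v).ncard = (Set.Ioi v).ncard + 1 := by
  rw [← Set.Ioi_insert, Set.ncard_insert_of_notMem (by simp)]

theorem hookLengths_congr {α β : Type*} [Fintype α] [Fintype β] [PartialOrder α] [PartialOrder β]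
    (e : α ≃o β) : hookLengths α = hookLengths β := by
  rw [hookLengths, hookLengths, ← Finset.univ_map_equiv_to_embedding e.toEquiv, Finset.map_val,
    Multiset.map_map]
  refine Multiset.map_congr rfl fun v _ => ?_
  have := Set.ncard_image_of_injective (Set.Ici v) e.injective
  rw [OrderIso.image_Ici] at this
  exact this.symm

theorem hookLengths_sum (α β : Type*) [Fintype α] [Fintype β] [PartialOrder α] [PartialOrder β] :
    hookLengths (α ⊕ β) = hookLengths α + hookLengths β := by
  rw [hookLengths, ← Finset.univ_disjSum_univ, Finset.val_disjSum, Multiset.disjSum,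
    Multiset.map_add, Multiset.map_map, Multiset.map_map]
  congr 1 <;> refine Multiset.map_congr rfl fun v _ => ?_
  · rw [Function.comp_apply, ← Set.ncard_image_of_injective (Set.Ici v)
      (Sum.inl_injective (β := β))]
    congr 1
    ext (x | x) <;> simp
  · rw [Function.comp_apply, ← Set.ncard_image_of_injective (Set.Ici v)
      (Sum.inr_injective (α := α))]
    congr 1
    ext (x | x) <;> simp

theorem hookLengths_withBot (α : Type*) [Fintype α] [PartialOrder α] :
    hookLengths (WithBot α) = (Fintype.card α + 1) ::ₘ hookLengths α := by
  have h : (Finset.univ : Finset (WithBot α)).val =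
      ⊥ ::ₘ (Finset.univ : Finset α).val.map WithBot.some := by
    change (Finset.univ : Finset (Option α)).val = none ::ₘ (Finset.univ : Finset α).val.map some
    rw [univ_option]
    rfl
  rw [hookLengths, h, Multiset.map_cons, Multiset.map_map]
  congr 1
  · rw [Set.Ici_bot, Set.ncard_univ, Nat.card_eq_fintype_card]
    exact Fintype.card_option
  · refine Multiset.map_congr rfl fun v _ => ?_
    rw [Function.comp_apply, ← Set.ncard_image_of_injective (Set.Ici v) WithBot.coe_injective]
    congr 1
    ext x
    induction x <;> simp

theorem IsForestOrder.sum {α β : Type*} [PartialOrder α] [PartialOrder β] (hα : IsForestOrder α)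
    (hβ : IsForestOrder β) : IsForestOrder (α ⊕ β) := by
  rintro (x | x) (y | y) (z | z) hx hy <;>
    simp only [Sum.inl_le_inl_iff, Sum.inr_le_inr_iff, Sum.not_inl_le_inr,
      Sum.not_inr_le_inl] at hx hy ⊢
  exacts [hα x y z hx hy, hβ x y z hx hy]

theorem IsForestOrder.withBot {α : Type*} [PartialOrder α] (hα : IsForestOrder α) :
    IsForestOrder (WithBot α) := by
  intro x y z hx hy
  induction x with
  | bot => exact Or.inl bot_le
  | coe x =>
    induction y with
    | bot => exact Or.inr bot_le
    | coe y =>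
      induction z with
      | bot => simp at hx
      | coe z => simpa using hα x y z (WithBot.coe_le_coe.1 hx) (WithBot.coe_le_coe.1 hy)

theorem isForestHookMultiset_zero : IsForestHookMultiset 0 :=
  ⟨Empty, inferInstance, inferInstance, fun x => x.elim, rfl⟩

theorem IsForestHookMultiset.add {G G' : Multiset ℕ} (h : IsForestHookMultiset G)
    (h' : IsForestHookMultiset G') : IsForestHookMultiset (G + G') := by
  obtain ⟨α, _, _, hα, rfl⟩ := h
  obtain ⟨β, _, _, hβ, rfl⟩ := h'
  exact ⟨α ⊕ β, inferInstance, inferInstance, hα.sum hβ, hookLengths_sum α β⟩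

theorem IsForestHookMultiset.cons {G : Multiset ℕ} (h : IsForestHookMultiset G) :
    IsForestHookMultiset ((G.card + 1) ::ₘ G) := by
  obtain ⟨α, _, _, hα, rfl⟩ := h
  refine ⟨WithBot α, inferInstance, inferInstance, hα.withBot, ?_⟩
  rw [hookLengths_withBot]
  simp [hookLengths]

/-- In a finite forest order, a nonempty set that is bounded above has a greatest element. -/
theorem IsForestOrder.exists_isGreatest {α : Type*} [Finite α] [PartialOrder α]
    (hα : IsForestOrder α) {S : Set α} (hS : S.Nonempty) {z : α} (hz : ∀ x ∈ S, x ≤ z) :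
    ∃ m, IsGreatest S m := by
  obtain ⟨m, hm⟩ := S.toFinite.exists_maximal hS
  exact ⟨m, hm.prop, fun x hx => (hα x m z (hz x hx) (hz m hm.prop)).elim id fun h => hm.2 hx h⟩

/-- A finite forest order with a least element is the order of a rooted tree. -/
theorem IsForestOrder.exists_rootedTree {α : Type} [Finite α] [PartialOrder α] [OrderBot α]
    (hα : IsForestOrder α) : ∃ T : RootedTree.{0}, Nonempty (T ≃o α) := by
  have hinf : ∀ x y : α, ∃ m, IsGreatest (lowerBounds {x, y}) m := fun x y =>
    hα.exists_isGreatest (z := x) ⟨⊥, by simp [lowerBounds]⟩ fun w hw => hw (by simp)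
  choose inf hinf using hinf
  -- A minimal element is its own predecessor; otherwise the elements strictly below `x` form a
  -- chain with a greatest member.
  have hpred : ∀ x : α, ∃ m ≤ x, (x ≤ m → IsMin x) ∧ ∀ y, y < x → y ≤ m := by
    intro x
    by_cases hx : IsMin x
    · exact ⟨x, le_rfl, fun _ => hx, fun y hy => hy.le⟩
    · obtain ⟨y, hy⟩ := not_isMin_iff.1 hx
      obtain ⟨m, hm, hm'⟩ := hα.exists_isGreatest (S := Set.Iio x) ⟨y, hy⟩ fun w hw => le_of_lt hw
      exact ⟨m, le_of_lt hm, fun h => absurd h (not_le_of_gt hm), fun y hy => hm' hy⟩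
  choose pr hle hmin hlt using hpred
  let _ : SemilatticeInf α := SemilatticeInf.ofIsGLB inf fun {a b} => hinf a b
  let _ : PredOrder α := ⟨pr, hle, fun {a} => hmin a, fun {a b} h => hlt b a h⟩
  exact ⟨⟨α⟩, ⟨OrderIso.refl α⟩⟩

theorem RootedTree.map_descendantCounts (T : RootedTree) [Fintype T] :
    T.descendantCounts.map (· + 1) = hookLengths T := by
  rw [RootedTree.descendantCounts, hookLengths, Multiset.map_map]
  exact Multiset.map_congr rfl fun v _ => (ncard_Ici v).symm

/-! ### From trees to `q`-binomial coefficients. -/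

/-- The quotient in the hook length formula of a forest, restricted to an upper set, is a product
of `q`-binomial coefficients. -/
theorem IsForestOrder.isProdQBinomial {α : Type*} [Fintype α] [PartialOrder α]
    (hα : IsForestOrder α) (S : Finset α) (hS : IsUpperSet (S : Set α)) :
    IsProdQBinomial (qFactorial S.card / ∏ v ∈ S, qNumber (Set.Ici v).ncard) := by
  classical
  induction S using Finset.strongInduction with
  | H S ih =>
  rcases S.eq_empty_or_nonempty with rfl | hne
  · simpa using IsProdQBinomial.one
  obtain ⟨x, hx⟩ := S.exists_minimal hne
  have hxS : x ∈ S := hx.prop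
  let U : Finset α := S.filter (x ≤ ·)
  have hU : (U : Set α) = Set.Ici x := by
    ext y
    simp only [U, Finset.coe_filter, Set.mem_ofPred_eq, Set.mem_Ici, and_iff_right_iff_imp]
    exact fun h => hS h hxS
  have hUc : (Set.Ici x).ncard = U.card := by rw [← hU, Set.ncard_coe_finset]
  by_cases hUS : U = S
  · have hup : IsUpperSet ((S.erase x : Finset α) : Set α) := by
      intro y z hyz hy
      rw [Finset.mem_coe, Finset.mem_erase] at hy ⊢
      refine ⟨?_, hS hyz hy.2⟩
      rintro rfl
      exact hy.1 (le_antisymm hyz (hx.2 hy.2 hyz))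
    have := ih _ (Finset.erase_ssubset hxS) hup
    rw [hUS] at hUc
    rw [← Finset.mul_prod_erase S _ hxS, hUc, ← Finset.card_erase_add_one hxS, qFactorial_succ]
    rwa [mul_comm (qFactorial _), mul_div_mul_left _ _ (qNumber_ne_zero (by omega))]
  · have hUsub : U ⊂ S := (Finset.filter_subset _ _).ssubset_of_ne hUS
    have hVsub : S \ U ⊂ S := Finset.sdiff_ssubset hUsub.1 ⟨x, by simp [U, hxS]⟩
    have hUup : IsUpperSet (U : Set α) := hU ▸ isUpperSet_Ici x
    have hVup : IsUpperSet ((S \ U : Finset α) : Set α) := by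
      intro y z hyz hy
      simp only [U, Finset.mem_coe, Finset.mem_sdiff, Finset.mem_filter, not_and] at hy ⊢
      refine ⟨hS hyz hy.1, fun _ hxz => hy.2 hy.1 ?_⟩
      -- `x` and `y` both lie below `z`, so they are comparable, and minimality of `x` gives `x ≤
      -- y`.
      exact (hα x y z hxz hyz).elim id fun h => hx.2 hy.1 h
    have hc : S.card = U.card + (S \ U).card := by
      rw [add_comm, Finset.card_sdiff_add_card_eq_card hUsub.1]
    have hprod := Finset.prod_sdiff (f := fun v => qNumber (Set.Ici v).ncard) hUsub.1
    have := (isProdQBinomial_qBinomial U.card (S \ U).card).mul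
      ((ih U hUsub hUup).mul (ih _ hVsub hVup))
    rw [← hprod, hc]
    convert! this using 1
    have h1 := qFactorial_ne_zero U.card
    have h2 := qFactorial_ne_zero (S \ U).card
    rw [qBinomial, div_mul_div_comm, div_mul_div_comm, mul_comm (∏ v ∈ S \ U, _),
      mul_comm (qFactorial (U.card + _)), mul_div_mul_left _ _ (mul_ne_zero h1 h2)]

theorem RootedTree.last_eq_and_isProdQBinomial (T : RootedTree) [Fintype T] {n : ℕ}
    {a : Fin (n + 1) → ℕ} (ha : Monotone a)
    (hT : T.descendantCounts = (Finset.univ : Finset (Fin (n + 1))).val.map a) :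
    a (Fin.last n) = n ∧
      IsProdQBinomial (qFactorial n / ∏ i : Fin n, qNumber (a i.castSucc + 1)) := by
  classical
  have hcard : Fintype.card T = n + 1 := by
    have := congrArg Multiset.card hT
    simpa [RootedTree.descendantCounts] using this
  have hIci : (Set.Ici (⊥ : T)).ncard = n + 1 := by
    rw [Set.Ici_bot, Set.ncard_univ, Nat.card_eq_fintype_card, hcard]
  have hbot : T.numDescendants ⊥ = n := by
    have := ncard_Ici (⊥ : T)
    rw [RootedTree.numDescendants]
    omega
  have hlast : a (Fin.last n) = n := by
    apply le_antisymm
    · have h : a (Fin.last n) ∈ T.descendantCounts := by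
        rw [hT]
        exact Multiset.mem_map_of_mem a (Finset.mem_univ_val _)
      obtain ⟨v, -, hv⟩ := Multiset.mem_map.1 h
      have h1 := ncard_Ici v
      have h2 := Set.ncard_le_ncard (Set.subset_univ (Set.Ici v))
      rw [Set.ncard_univ, Nat.card_eq_fintype_card, hcard] at h2
      rw [← hv, RootedTree.numDescendants]
      omega
    · have h : n ∈ T.descendantCounts :=
        Multiset.mem_map.2 ⟨⊥, Finset.mem_univ _, hbot⟩
      rw [hT] at h
      obtain ⟨i, -, hi⟩ := Multiset.mem_map.1 h
      exact hi.symm.trans_le (ha (Fin.le_last i))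
  refine ⟨hlast, ?_⟩
  have hup : IsUpperSet (((Finset.univ : Finset T).erase ⊥ : Finset T) : Set T) := by
    intro x y hxy hx
    simp only [Finset.coe_erase, Finset.coe_univ, Set.mem_sdiff, Set.mem_univ,
      Set.mem_singleton_iff, true_and] at hx ⊢
    rintro rfl
    exact hx (le_bot_iff.1 hxy)
  have h := T.isForestOrder.isProdQBinomial _ hup
  rw [Finset.card_erase_of_mem (Finset.mem_univ _), Finset.card_univ, hcard,
    Nat.add_sub_cancel] at h
  have hprod : ∏ v : T, qNumber (Set.Ici v).ncard = ∏ i, qNumber (a i + 1) := by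
    have h1 := congrArg (fun m => (m.map qNumber).prod) T.map_descendantCounts
    simp only [hT, hookLengths, Multiset.map_map] at h1
    exact h1.symm
  rw [← Finset.mul_prod_erase _ _ (Finset.mem_univ (⊥ : T)), Fin.prod_univ_castSucc, hlast, hIci,
    mul_comm] at hprod
  rwa [mul_right_cancel₀ (qNumber_ne_zero (by omega)) hprod] at h

/-! ### From `q`-binomial coefficients to trees. -/

/-- If the quotient of a `q`-factorial by `q`-numbers is a product of `q`-binomial coefficients,
then the `q`-numbers are those of the hook lengths of a forest. -/
theorem isForestHookMultiset_of_isProdQBinomial {H : Multiset ℕ} (hH : ∀ k ∈ H, 1 ≤ k)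
    (h : IsProdQBinomial (qFactorial H.card / (H.map qNumber).prod)) :
    IsForestHookMultiset H := by
  obtain ⟨B, hB, hq⟩ := h.exists_pos
  obtain ⟨s, r, hs, hsn, hsum⟩ := exists_multiset_of_countP_eq isForestHookMultiset_zero
    (fun _ _ => IsForestHookMultiset.add) (fun _ => IsForestHookMultiset.cons) {H.card}
    (H.filter (2 ≤ ·)) B (by simp) hB (by
      intro k hk
      rw [count_eq_of_qFactorial_div_eq hH hq hk, Multiset.count_filter, if_pos hk])
  obtain ⟨G, rfl, hG⟩ := Multiset.map_eq_singleton.1 hsn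
  rw [Multiset.sum_singleton] at hsum
  have hH1 : H = H.filter (2 ≤ ·) +
      Multiset.replicate (H.filter (¬ 2 ≤ ·)).card 1 := by
    conv_lhs => rw [← Multiset.filter_add_not (2 ≤ ·) H]
    congr 1
    refine Multiset.eq_replicate_card.2 fun k hk => ?_
    rw [Multiset.mem_filter] at hk
    have := hH k hk.1
    omega
  -- The `q`-numbers do not see the number of ones; it is fixed because the forest has `H.card`
  -- vertices.
  have hr : r = (H.filter (¬ 2 ≤ ·)).card := by
    have h1 := congrArg Multiset.card hsum
    have h2 := congrArg Multiset.card hH1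
    rw [Multiset.card_add, Multiset.card_replicate] at h1 h2
    omega
  rw [hH1, ← hr, ← hsum]
  exact hs G (Multiset.mem_singleton_self G)

/-- A forest with a root attached is a rooted tree. -/
theorem IsForestHookMultiset.exists_rootedTree {D : Multiset ℕ}
    (h : IsForestHookMultiset (D.map (· + 1))) :
    ∃ (T : RootedTree.{0}) (_ : Fintype T), T.descendantCounts = D.card ::ₘ D := by
  obtain ⟨α, _, _, hα, hD⟩ := h
  obtain ⟨T, ⟨e⟩⟩ := hα.withBot.exists_rootedTree
  have hc : Fintype.card α = D.card := by
    have := congrArg Multiset.card hD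
    simpa [hookLengths] using this
  let _ : Fintype T := Fintype.ofEquiv _ e.symm.toEquiv
  refine ⟨T, inferInstance, Multiset.map_injective (add_left_injective 1) ?_⟩
  rw [RootedTree.map_descendantCounts, hookLengths_congr e, hookLengths_withBot, hD, hc,
    Multiset.map_cons]

/-- The tuple is `a 0 ≤ a 1 ≤ ⋯ ≤ a n`, of length `n + 1`, with largest entry `a (Fin.last n)`. -/
theorem theorem5p2 (n : ℕ) (a : Fin (n + 1) → ℕ) (ha : Monotone a) :
    (∃ (T : RootedTree.{0}) (_ : Fintype T),
        T.descendantCounts = (Finset.univ : Finset (Fin (n + 1))).val.map a) ↔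
      a (Fin.last n) = n ∧
        IsProdQBinomial
          (qFactorial (a (Fin.last n)) / ∏ i : Fin n, qNumber (a i.castSucc + 1)) := by
  constructor
  · rintro ⟨T, _, hT⟩
    have h := T.last_eq_and_isProdQBinomial ha hT
    exact ⟨h.1, by rw [h.1]; exact h.2⟩
  · rintro ⟨hlast, hq⟩
    have hcard : ((Finset.univ : Finset (Fin n)).val.map fun i => a i.castSucc).card = n := by simp
    obtain ⟨T, hT, h⟩ := IsForestHookMultiset.exists_rootedTree
      (D := (Finset.univ : Finset (Fin n)).val.map fun i => a i.castSucc)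
      (isForestHookMultiset_of_isProdQBinomial (by simp) (by
        rw [Multiset.card_map, hcard, Multiset.map_map, Multiset.map_map]
        rwa [hlast] at hq))
    refine ⟨T, hT, ?_⟩
    rw [h, hcard, Fin.univ_castSuccEmb, Finset.cons_val, Multiset.map_cons, hlast, Finset.map_val,
      Multiset.map_map]
    rfl
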